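/- Let $0<q<1$ and put $\kappa=-\frac{2\pi}{\ln q}>0$. Write $(a;q)_n=\prod_{j=0}^{n-1}(1-aq^j)$ for $n\ge 0$, and $(a;q)_\infty=\lim_{n\to\infty}(a;q)_n=\prod_{j\ge 0}(1-aq^j)$. For $\mu,x\in\mathbb C$ let $$F(\mu;q,x)=\sum_{n\ge 0}\frac{(q^\mu;q)_n}{n!}(-x)^n,$$ an entire function of $x$, and for $u,z\in\mathbb C$, $v\in\mathbb R$ with $z\neq 0$ let $$\Psi(u,v,z)=\sum_{n\in\mathbb Z}\Gamma\Bigl(u+\frac{2ivn}{\pi}\Bigr)z^n$$ whenever no argument of $\Gamma$ is a pole and the Laurent series converges absolutely. Let $\mu\in\mathbb C$ be such that $\mu\ne -m+k\kappa i$ for all integers $m\ge 0$ and $k\in\mathbb Z$. Then for every $x\in\mathbb C$ with $\operatorname{Re}x>0$, with principal branches of the complex powers and the modular variable $$x^*=x^{-\kappa i}=e^{2\pi i\frac{\log x}{\ln q}},$$ the Laurent series $\Psi(\mu+n,\frac{\kappa\pi}2,x^*)$ converges absolutely for every $n\ge 0$, the series over $n$ below converges absolutely, and $$F(\mu;q,x)=\frac{\kappa\,(q^\mu;q)_\infty}{2\pi\,(q;q)_\infty}\Bigl(\frac1x\Bigr)^{\mu}\sum_{n\ge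 0}\frac{q^{n(n+1)/2}}{(q;q)_n}\,\Psi\Bigl(\mu+n,\frac{\kappa\pi}{2},x^*\Bigr)\Bigl(-\frac1x\Bigr)^n .$$ -/

import Mathlib

/-- The finite `q`-shifted factorial `(a; q)_n = ∏_{j < n} (1 - a q ^ j)`. -/
noncomputable def qPoch (a : ℂ) (q : ℝ) (n : ℕ) : ℂ :=
  ∏ j ∈ Finset.range n, (1 - a * (q : ℂ) ^ j)

/-- The infinite `q`-shifted factorial `(a; q)_∞ = ∏_{j ≥ 0} (1 - a q ^ j)`, for `0 < q < 1`. -/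
noncomputable def qPochInf (a : ℂ) (q : ℝ) : ℂ :=
  ∏' j : ℕ, (1 - a * (q : ℂ) ^ j)

/-- The infinite `q`-shifted factorial is the limit of the finite ones. -/
theorem tendsto_qPoch (a : ℂ) {q : ℝ} (hq0 : 0 < q) (hq1 : q < 1) :
    Filter.Tendsto (qPoch a q) Filter.atTop (nhds (qPochInf a q)) := by
  have hs : Summable fun j : ℕ => ‖-(a * (q : ℂ) ^ j)‖ := by
    have := (summable_geometric_of_lt_one hq0.le hq1).mul_left ‖a‖
    simpa [abs_of_pos hq0] using this
  have hm := (multipliable_one_add_of_summable hs).hasProd.tendsto_prod_nat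
  simpa [qPoch, qPochInf, sub_eq_add_neg, Function.comp_def] using! hm

/-- The positive number `κ = κ_q = -2π / ln q`. -/
noncomputable def qKappa (q : ℝ) : ℝ := -(2 * Real.pi) / Real.log q

/-- The entire function `F(μ; q, x) = ∑_{n ≥ 0} (q^μ; q)_n / n! (-x)^n`. -/
noncomputable def pantographF (μ : ℂ) (q : ℝ) (x : ℂ) : ℂ :=
  ∑' n : ℕ, qPoch ((q : ℂ) ^ μ) q n / (n.factorial : ℂ) * (-x) ^ n

/-- The power series that defines `F(μ; q, x)` converges for every complex `x`. -/
theorem summable_pantographF (μ : ℂ) {q : ℝ} (hq0 : 0 < q) (hq1 : q < 1) (x : ℂ) :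
    Summable fun n : ℕ => qPoch ((q : ℂ) ^ μ) q n / (n.factorial : ℂ) * (-x) ^ n := by
  set a : ℂ := (q : ℂ) ^ μ
  refine Summable.of_norm_bounded
    (Real.summable_pow_div_factorial ((1 + ‖a‖) * ‖x‖)) fun n => ?_
  have hb : ‖qPoch a q n‖ ≤ (1 + ‖a‖) ^ n := by
    unfold qPoch
    rw [norm_prod]
    refine (Finset.prod_le_prod (fun _ _ => norm_nonneg _) (g := fun _ => 1 + ‖a‖)
      fun j _ => ?_).trans (by simp)
    refine (norm_sub_le _ _).trans ?_
    have : q ^ j ≤ 1 := pow_le_one₀ hq0.le hq1.le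
    have h2 := mul_le_mul_of_nonneg_left this (norm_nonneg a)
    simpa [abs_of_pos hq0] using h2
  rw [norm_mul, norm_div, norm_pow, norm_neg, mul_pow, Complex.norm_natCast]
  calc ‖qPoch a q n‖ / (n.factorial : ℝ) * ‖x‖ ^ n
      ≤ (1 + ‖a‖) ^ n / (n.factorial : ℝ) * ‖x‖ ^ n := by gcongr
    _ = _ := by ring

/-- The `n`-th term `Γ(u + 2 i v n / π) z ^ n` of the Laurent series `Ψ(u, v, z)`. -/
noncomputable def psiTerm (u : ℂ) (v : ℝ) (z : ℂ) (n : ℤ) : ℂ :=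
  Complex.Gamma (u + 2 * Complex.I * (v : ℂ) * (n : ℂ) / (Real.pi : ℂ)) * z ^ n

/-- The Laurent series `Ψ(u, v, z) = ∑_{n ∈ ℤ} Γ(u + 2 i v n / π) z ^ n`. -/
noncomputable def gammaPsi (u : ℂ) (v : ℝ) (z : ℂ) : ℂ :=
  ∑' n : ℤ, psiTerm u v z n

/-- The modular variable `x* = x ^ (-κ i)`, with the principal branch of the power. -/
noncomputable def modularVar (q : ℝ) (x : ℂ) : ℂ :=
  x ^ (-((qKappa q : ℂ) * Complex.I))

/-- The modular variable is also `x* = exp (2 π i log x / ln q)`. -/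
theorem modularVar_eq_exp (q : ℝ) {x : ℂ} (hx : x ≠ 0) :
    modularVar q x =
      Complex.exp (2 * (Real.pi : ℂ) * Complex.I * (Complex.log x / (Real.log q : ℂ))) := by
  rw [modularVar, Complex.cpow_def_of_ne_zero hx, qKappa]
  congr 1
  push_cast
  ring

/-! Write a = q^μ. When |a| < 1, (a;q)_n equals (a;q)_∞ / (a q^n;q)_∞. Expanding the reciprocal by
Euler's series and exchanging sums turns F into (a;q)_∞ ∑_{k ≥ 0} a^k exp(-x q^k) / (q;q)_k
(`pantographF_eq_tsum_exp`). The weight 1/(q;q)_k is (q^{k+1};q)_∞ / (q;q)_∞, and (q^{k+1};q)_∞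
vanishes for k < 0, so the sum may run over all integers k (`tsum_eulerEntire_mul`). Expanding this
weight by Euler's other series in powers of q^k leaves bilateral sums ∑_k q^{k(μ+n)} exp(-x q^k).
Poisson summation (`tsum_expTerm`) turns each into a sum of Γ(s) x^{-s} over s = μ + n + κmi,
because the Fourier transform of the summand is a Mellin transform of exp(-xt). This settles Re μ ≥
1.

Other exponents follow by descent from μ + 1 to μ (`pantographF_eq_of_add_one`). For both sides, the
x-derivative and the combination f(x) - q^μ f(qx) are expressed by the case μ + 1. The difference D
of the sides is therefore constant with D = q^μ D, and q^μ ≠ 1 forces D = 0.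

All exchanges on the Γ side rest on absolute, locally uniform convergence of the double series
(`exists_summable_bound`): q^{n(n+1)/2} beats the growth of Γ in n, and rotating x by a small angle
extracts exponential decay in m. -/

/-! ### Euler's integral for Γ with complex scaling -/

/-- `t ^ p * exp (-ρ t)` is integrable on the positive half-line. -/
theorem integrableOn_rpow_mul_exp_neg {p ρ : ℝ} (hp : -1 < p) (hρ : 0 < ρ) :
    MeasureTheory.IntegrableOn (fun t : ℝ => t ^ p * Real.exp (-(ρ * t))) (Set.Ioi 0) := by
  have h := integrableOn_rpow_mul_exp_neg_mul_rpow hp one_pos hρ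
  refine h.congr_fun (fun t _ => ?_) measurableSet_Ioi
  simp

theorem aestronglyMeasurable_cpow_mul_exp_neg (a r : ℂ) :
    MeasureTheory.AEStronglyMeasurable
      (fun t : ℝ => (t : ℂ) ^ a * Complex.exp (-(r * t)))
      (MeasureTheory.volume.restrict (Set.Ioi 0)) := by
  refine ContinuousOn.aestronglyMeasurable (fun t ht => ?_) measurableSet_Ioi
  refine ContinuousAt.continuousWithinAt (ContinuousAt.mul ?_ (by fun_prop))
  exact Complex.continuousAt_ofReal_cpow_const t a (Or.inr (ne_of_gt ht))

theorem norm_cpow_mul_exp_neg (a r : ℂ) {t : ℝ} (ht : 0 < t) :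
    ‖(t : ℂ) ^ a * Complex.exp (-(r * t))‖ = t ^ a.re * Real.exp (-(r.re * t)) := by
  rw [norm_mul, Complex.norm_cpow_eq_rpow_re_of_pos ht, Complex.norm_exp]
  simp

theorem integrableOn_cpow_mul_exp_neg {a r : ℂ} (ha : -1 < a.re) (hr : 0 < r.re) :
    MeasureTheory.IntegrableOn (fun t : ℝ => (t : ℂ) ^ a * Complex.exp (-(r * t)))
      (Set.Ioi 0) := by
  refine MeasureTheory.Integrable.mono' (integrableOn_rpow_mul_exp_neg ha hr)
    (aestronglyMeasurable_cpow_mul_exp_neg a r) ?_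
  filter_upwards [MeasureTheory.ae_restrict_mem measurableSet_Ioi] with t ht
  exact (norm_cpow_mul_exp_neg a r ht).le

theorem differentiableAt_integral_cpow_mul_exp_neg {a r : ℂ} (ha : -1 < a.re) (hr : 0 < r.re) :
    DifferentiableAt ℂ
      (fun r : ℂ => ∫ t : ℝ in Set.Ioi 0, (t : ℂ) ^ a * Complex.exp (-(r * t))) r := by
  -- Halving the real part gives a neighbourhood of r on which a single integrable function
  -- dominates the derivative.
  have hs : {z : ℂ | r.re / 2 < z.re} ∈ nhds r :=
    (isOpen_lt continuous_const Complex.continuous_re).mem_nhds (by simp; linarith)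
  have key := hasDerivAt_integral_of_dominated_loc_of_deriv_le
    (μ := MeasureTheory.volume.restrict (Set.Ioi (0 : ℝ)))
    (F := fun (r : ℂ) (t : ℝ) => (t : ℂ) ^ a * Complex.exp (-(r * t)))
    (F' := fun (r : ℂ) (t : ℝ) => -((t : ℂ) ^ (a + 1) * Complex.exp (-(r * t))))
    (bound := fun t : ℝ => t ^ (a.re + 1) * Real.exp (-(r.re / 2 * t))) hs
    (Filter.Eventually.of_forall fun r => aestronglyMeasurable_cpow_mul_exp_neg a r)
    (integrableOn_cpow_mul_exp_neg ha hr)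
    (aestronglyMeasurable_cpow_mul_exp_neg (a + 1) r).neg ?_
    (integrableOn_rpow_mul_exp_neg (by linarith) (by linarith)) ?_
  · exact key.2.differentiableAt
  · filter_upwards [MeasureTheory.ae_restrict_mem measurableSet_Ioi] with t ht z hz
    rw [Set.mem_Ioi] at ht
    have hz' : r.re / 2 < z.re := hz
    rw [norm_neg, norm_cpow_mul_exp_neg _ _ ht, Complex.add_re, Complex.one_re]
    gcongr
  · filter_upwards [MeasureTheory.ae_restrict_mem measurableSet_Ioi] with t ht z hz
    have h0 : (t : ℂ) ≠ 0 := Complex.ofReal_ne_zero.2 (ne_of_gt ht)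
    have h1 : HasDerivAt (fun z : ℂ => -(z * t)) (-(1 * (t : ℂ))) z :=
      ((hasDerivAt_id z).mul_const (t : ℂ)).neg
    refine (h1.cexp.const_mul ((t : ℂ) ^ a)).congr_deriv ?_
    rw [Complex.cpow_add _ _ h0, Complex.cpow_one]
    ring

theorem isOpen_rightHalfPlane : IsOpen {z : ℂ | 0 < z.re} :=
  isOpen_lt continuous_const Complex.continuous_re

theorem convex_rightHalfPlane : Convex ℝ {z : ℂ | 0 < z.re} :=
  convex_halfSpace_re_gt 0

theorem mem_slitPlane_of_re_pos {x : ℂ} (hx : 0 < x.re) : x ∈ Complex.slitPlane := Or.inl hx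

/-- Euler's integral for `Γ`, with a complex scaling parameter in the right half-plane. -/
theorem integral_cpow_mul_exp_neg_eq_Gamma {s r : ℂ} (hs : 0 < s.re) (hr : 0 < r.re) :
    ∫ t : ℝ in Set.Ioi 0, (t : ℂ) ^ (s - 1) * Complex.exp (-(r * t)) =
      Complex.Gamma s * Complex.exp (-(s * Complex.log r)) := by
  have hs1 : -1 < (s - 1).re := by simp [hs]
  have hL : AnalyticOnNhd ℂ
      (fun r : ℂ => ∫ t : ℝ in Set.Ioi 0, (t : ℂ) ^ (s - 1) * Complex.exp (-(r * t)))
      {z : ℂ | 0 < z.re} :=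
    DifferentiableOn.analyticOnNhd (fun z hz =>
      (differentiableAt_integral_cpow_mul_exp_neg hs1 hz).differentiableWithinAt)
      isOpen_rightHalfPlane
  have hR : AnalyticOnNhd ℂ
      (fun r : ℂ => Complex.Gamma s * Complex.exp (-(s * Complex.log r)))
      {z : ℂ | 0 < z.re} := by
    refine DifferentiableOn.analyticOnNhd (fun z hz => ?_) isOpen_rightHalfPlane
    have := (Complex.differentiableAt_log (mem_slitPlane_of_re_pos hz))
    exact ((this.const_mul s).neg.cexp.const_mul _).differentiableWithinAt
  -- Identity theorem: the sides agree for real positive r, in particular at the points 1 + 1/(n+1),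
  -- which differ from 1 and accumulate there.
  refine hL.eqOn_of_preconnected_of_mem_closure hR convex_rightHalfPlane.isPreconnected
    (z₀ := 1) (by simp) ?_ hr
  rw [mem_closure_iff_seq_limit]
  refine ⟨fun n : ℕ => ((1 + 1 / ((n : ℝ) + 1) : ℝ) : ℂ), fun n => ⟨?_, ?_⟩, ?_⟩
  · have hpos : (0 : ℝ) < 1 + 1 / ((n : ℝ) + 1) := by positivity
    rw [Set.mem_ofPred_eq, Complex.integral_cpow_mul_exp_neg_mul_Ioi hs hpos, mul_comm,
      Complex.cpow_def_of_ne_zero (one_div_ne_zero (Complex.ofReal_ne_zero.2 hpos.ne')),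
      one_div, Complex.log_inv _ (by rw [Complex.arg_ofReal_of_nonneg hpos.le]; exact Real.pi_pos.ne)]
    ring_nf
  · rw [Set.mem_singleton_iff, ← Complex.ofReal_one, Complex.ofReal_inj]
    have : (0 : ℝ) < 1 / ((n : ℝ) + 1) := by positivity
    linarith
  · have h := (tendsto_const_nhds (x := (1 : ℝ))).add
      (tendsto_one_div_add_atTop_nhds_zero_nat (𝕜 := ℝ))
    rw [add_zero] at h
    exact_mod_cast (Complex.continuous_ofReal.tendsto 1).comp h

/-! ### The function Γ(s) x^{-s}: decay and recurrences -/

/-- The term `Γ(s) x ^ (-s)`, with the principal branch of the power. -/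
noncomputable def gammaPow (s x : ℂ) : ℂ :=
  Complex.Gamma s * Complex.exp (-(s * Complex.log x))

/-- Taking norms inside Euler's integral discards Im s; the decay in Im s comes only after a
rotation of x. -/
theorem norm_gammaPow_le {s x : ℂ} (hs : 0 < s.re) (hx : 0 < x.re) :
    ‖gammaPow s x‖ ≤ Real.Gamma s.re * (1 / x.re) ^ s.re := by
  rw [gammaPow, ← integral_cpow_mul_exp_neg_eq_Gamma hs hx, mul_comm,
    ← Real.integral_rpow_mul_exp_neg_mul_Ioi hs hx]
  refine (MeasureTheory.norm_integral_le_integral_norm _).trans_eq ?_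
  refine MeasureTheory.setIntegral_congr_fun measurableSet_Ioi fun t ht => ?_
  have := norm_cpow_mul_exp_neg (s - 1) x ht
  simpa using this

/-- The arguments of x and of the rotation both lie in (-π/2, π/2), so the principal logarithms add.
The extra factor has modulus exp(d Im s), which is the source of the decay. -/
theorem gammaPow_mul_exp {s x : ℂ} {d : ℝ} (hx : 0 < x.re) (hd : |d| < Real.pi / 2) :
    gammaPow s (x * Complex.exp (d * Complex.I)) =
      gammaPow s x * Complex.exp (-(s * (d * Complex.I))) := by
  have hx0 : x ≠ 0 := by rintro rfl; simp at hx
  have hpi := Real.pi_pos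
  have hda := abs_lt.1 hd
  have harg := abs_lt.1 (Complex.abs_arg_lt_pi_div_two_iff.2 (Or.inl hx))
  have harg' : (Complex.exp (d * Complex.I)).arg = d := by
    rw [Complex.arg_exp_mul_I, toIocMod_eq_self]
    constructor <;> linarith
  have hlog : Complex.log (x * Complex.exp (d * Complex.I)) = Complex.log x + d * Complex.I := by
    rw [Complex.log_mul hx0 (Complex.exp_ne_zero _), Complex.log_exp]
    · simp; linarith
    · simp; linarith
    · rw [harg']; constructor <;> linarith
  rw [gammaPow, gammaPow, hlog, mul_assoc, ← Complex.exp_add]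
  ring_nf

/-- Exponential decay of `Γ(s) x ^ (-s)` in vertical strips, uniformly in `x`. -/
theorem norm_gammaPow_le_exp {s x : ℂ} {r R δ ρ : ℝ} (hs : 0 < s.re) (hx : r ≤ x.re)
    (hxR : ‖x‖ ≤ R) (hδ0 : 0 ≤ δ) (hδ : δ < Real.pi / 2) (hρ : 0 < ρ)
    (h : ρ ≤ r * Real.cos δ - R * Real.sin δ) (hr : 0 < r) :
    ‖gammaPow s x‖ ≤ Real.exp (-(δ * |s.im|)) * (Real.Gamma s.re * (1 / ρ) ^ s.re) := by
  -- The direction of rotation follows the sign of Im s, so that the extra factor has modulus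
  -- exp(δ|Im s|) ≥ 1.
  obtain ⟨d, hd, hds⟩ : ∃ d : ℝ, |d| = δ ∧ d * s.im = δ * |s.im| := by
    rcases le_total 0 s.im with h | h
    · exact ⟨δ, abs_of_nonneg hδ0, by rw [abs_of_nonneg h]⟩
    · exact ⟨-δ, by rw [abs_neg, abs_of_nonneg hδ0], by rw [abs_of_nonpos h]; ring⟩
  have hcos : Real.cos d = Real.cos δ := by rw [← Real.cos_abs, hd]
  have hsin : |Real.sin d| = Real.sin δ := by
    rw [← hd, Real.abs_sin_eq_sin_abs_of_abs_le_pi (by linarith [Real.pi_pos])]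
  have hy : (x * Complex.exp (d * Complex.I)).re = x.re * Real.cos d - x.im * Real.sin d := by
    rw [Complex.exp_mul_I, ← Complex.ofReal_cos, ← Complex.ofReal_sin]
    simp only [Complex.mul_re, Complex.add_re, Complex.add_im, Complex.mul_im, Complex.ofReal_re,
      Complex.ofReal_im, Complex.I_re, Complex.I_im]
    ring
  have hρy : ρ ≤ (x * Complex.exp (d * Complex.I)).re := by
    have hc : 0 ≤ Real.cos δ := Real.cos_nonneg_of_mem_Icc ⟨by linarith, hδ.le⟩
    have h1 : x.im * Real.sin d ≤ R * Real.sin δ := by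
      refine (le_abs_self _).trans ?_
      rw [abs_mul, hsin]
      exact mul_le_mul_of_nonneg_right ((Complex.abs_im_le_norm x).trans hxR)
        (hsin ▸ abs_nonneg _)
    rw [hy, hcos]
    nlinarith
  have key := gammaPow_mul_exp (s := s) (d := d) (x := x) (by linarith) (by rwa [hd])
  have hn : ‖Complex.exp (-(s * (d * Complex.I)))‖ = Real.exp (δ * |s.im|) := by
    rw [Complex.norm_exp, ← hds]
    congr 1
    simp
    ring
  have hb := norm_gammaPow_le hs (x := x * Complex.exp (d * Complex.I)) (by linarith)
  rw [key, norm_mul, hn] at hb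
  have hb2 : ‖gammaPow s x‖ * Real.exp (δ * |s.im|) ≤ Real.Gamma s.re * (1 / ρ) ^ s.re := by
    refine hb.trans ?_
    have := Real.Gamma_pos_of_pos hs
    have hy0 := one_div_nonneg.2 (hρ.le.trans hρy)
    gcongr
  rw [Real.exp_neg, inv_mul_eq_div, le_div_iff₀ (Real.exp_pos _)]
  exact hb2

theorem gammaPow_add_one {s x : ℂ} (hs : s ≠ 0) (hx : x ≠ 0) :
    gammaPow (s + 1) x = s / x * gammaPow s x := by
  rw [gammaPow, gammaPow, Complex.Gamma_add_one s hs, add_mul, neg_add, Complex.exp_add, one_mul,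
    Complex.exp_neg (Complex.log x), Complex.exp_log hx]
  field_simp

/-- Since s Γ(s) = Γ(s+1), differentiation in x shifts the exponent by one; this drives the descent
in μ. -/
theorem hasDerivAt_gammaPow {s x : ℂ} (hs : s ≠ 0) (hx : 0 < x.re) :
    HasDerivAt (gammaPow s) (-gammaPow (s + 1) x) x := by
  have hx0 : x ≠ 0 := by rintro rfl; simp at hx
  have h := (((Complex.hasDerivAt_log (mem_slitPlane_of_re_pos hx)).const_mul s).neg.cexp).const_mul
    (Complex.Gamma s)
  refine h.congr_deriv ?_
  rw [gammaPow_add_one hs hx0, gammaPow, Pi.neg_apply]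
  ring

/-! ### q-shifted factorials and Euler's two series -/

theorem qPoch_zero (a : ℂ) (q : ℝ) : qPoch a q 0 = 1 := by simp [qPoch]

theorem qPoch_succ (a : ℂ) (q : ℝ) (n : ℕ) :
    qPoch a q (n + 1) = qPoch a q n * (1 - a * (q : ℂ) ^ n) := Finset.prod_range_succ _ _

theorem qPoch_succ' (a : ℂ) (q : ℝ) (n : ℕ) :
    qPoch a q (n + 1) = (1 - a) * qPoch (a * q) q n := by
  rw [qPoch, Finset.prod_range_succ', qPoch, mul_comm]
  congr 1
  · simp
  · exact Finset.prod_congr rfl fun j _ => by ring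

theorem norm_one_sub_pow_succ {q : ℝ} (hq0 : 0 < q) (hq1 : q < 1) (n : ℕ) :
    ‖(1 : ℂ) - (q : ℂ) ^ (n + 1)‖ = 1 - q ^ (n + 1) := by
  have : q ^ (n + 1) < 1 := pow_lt_one₀ hq0.le hq1 (by simp)
  rw [← Complex.ofReal_pow, ← Complex.ofReal_one, ← Complex.ofReal_sub, Complex.norm_real,
    Real.norm_of_nonneg (by linarith)]

theorem one_sub_pow_succ_pos {q : ℝ} (hq0 : 0 < q) (hq1 : q < 1) (n : ℕ) :
    0 < 1 - q ^ (n + 1) := by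
  have : q ^ (n + 1) < 1 := pow_lt_one₀ hq0.le hq1 (by simp)
  linarith

theorem one_sub_pow_succ_ne_zero {q : ℝ} (hq0 : 0 < q) (hq1 : q < 1) (n : ℕ) :
    (1 : ℂ) - (q : ℂ) ^ (n + 1) ≠ 0 := by
  rw [← norm_pos_iff, norm_one_sub_pow_succ hq0 hq1]
  exact one_sub_pow_succ_pos hq0 hq1 n

theorem qPoch_self_succ (q : ℝ) (n : ℕ) :
    qPoch q q (n + 1) = qPoch q q n * (1 - (q : ℂ) ^ (n + 1)) := by
  rw [qPoch_succ, pow_succ']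

theorem qPoch_self_ne_zero {q : ℝ} (hq0 : 0 < q) (hq1 : q < 1) (n : ℕ) : qPoch q q n ≠ 0 := by
  refine Finset.prod_ne_zero_iff.2 fun j _ => ?_
  rw [← pow_succ']
  exact one_sub_pow_succ_ne_zero hq0 hq1 j

theorem tendsto_one_sub_pow_succ {q : ℝ} (hq0 : 0 < q) (hq1 : q < 1) :
    Filter.Tendsto (fun n : ℕ => 1 - q ^ (n + 1)) Filter.atTop (nhds 1) := by
  have h := (Filter.tendsto_add_atTop_iff_nat 1).2 (tendsto_pow_atTop_nhds_zero_of_lt_one hq0.le hq1)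
  simpa using tendsto_const_nhds (x := (1 : ℝ)).sub h

/-- The coefficient `q ^ (n (n + 1) / 2) / (q; q)_n`. -/
noncomputable def qCoef (q : ℝ) (n : ℕ) : ℂ := (q : ℂ) ^ (n * (n + 1) / 2) / qPoch q q n

theorem qCoef_zero (q : ℝ) : qCoef q 0 = 1 := by simp [qCoef, qPoch_zero]

theorem qCoef_succ {q : ℝ} (hq0 : 0 < q) (hq1 : q < 1) (n : ℕ) :
    qCoef q (n + 1) * (1 - (q : ℂ) ^ (n + 1)) = qCoef q n * (q : ℂ) ^ (n + 1) := by
  have h1 : (n + 1) * (n + 1 + 1) / 2 = n * (n + 1) / 2 + (n + 1) := by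
    rw [show (n + 1) * (n + 1 + 1) = n * (n + 1) + (n + 1) * 2 by ring,
      Nat.add_mul_div_right _ _ two_pos]
  have h2 := one_sub_pow_succ_ne_zero hq0 hq1 n
  have h3 := qPoch_self_ne_zero hq0 hq1 n
  rw [qCoef, qCoef, h1, qPoch_self_succ, pow_add]
  field_simp

theorem qCoef_ne_zero {q : ℝ} (hq0 : 0 < q) (hq1 : q < 1) (n : ℕ) : qCoef q n ≠ 0 :=
  div_ne_zero (pow_ne_zero _ (Complex.ofReal_ne_zero.2 hq0.ne')) (qPoch_self_ne_zero hq0 hq1 n)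

theorem norm_qCoef_succ {q : ℝ} (hq0 : 0 < q) (hq1 : q < 1) (n : ℕ) :
    ‖qCoef q (n + 1)‖ = ‖qCoef q n‖ * q ^ (n + 1) / (1 - q ^ (n + 1)) := by
  have h := congrArg norm (qCoef_succ hq0 hq1 n)
  rw [norm_mul, norm_mul, norm_one_sub_pow_succ hq0 hq1, norm_pow, Complex.norm_real,
    Real.norm_of_nonneg hq0.le] at h
  rw [eq_div_iff (one_sub_pow_succ_pos hq0 hq1 n).ne', h]

theorem summable_of_tendsto_ratio {u c : ℕ → ℝ} {l : ℝ} (hu : ∀ n, 0 ≤ u n) (hl : l < 1)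
    (h : ∀ n, u (n + 1) = c n * u n) (hc : Filter.Tendsto c Filter.atTop (nhds l)) :
    Summable u := by
  obtain ⟨r, hlr, hr⟩ := exists_between hl
  refine summable_of_ratio_norm_eventually_le hr ?_
  filter_upwards [hc.eventually (gt_mem_nhds hlr)] with n hn
  rw [Real.norm_of_nonneg (hu _), Real.norm_of_nonneg (hu _), h]
  exact mul_le_mul_of_nonneg_right hn.le (hu n)

/-- Ratio test: consecutive terms have ratio (σ + n) ρ q^{n+1} / (1 - q^{n+1}), which tends to 0. -/
theorem summable_norm_qCoef_mul_Gamma {q σ ρ : ℝ} (hq0 : 0 < q) (hq1 : q < 1) (hσ : 0 < σ)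
    (hρ : 0 < ρ) : Summable fun n : ℕ => ‖qCoef q n‖ * (Real.Gamma (σ + n) * ρ ^ n) := by
  refine summable_of_tendsto_ratio (l := 0)
    (c := fun n : ℕ => (σ * q ^ n + n * q ^ n) * (q * ρ) / (1 - q ^ (n + 1))) (fun n => ?_)
    one_pos (fun n => ?_) ?_
  · have := Real.Gamma_pos_of_pos (s := σ + n) (by positivity)
    positivity
  · have h1 := (one_sub_pow_succ_pos hq0 hq1 n).ne'
    rw [norm_qCoef_succ hq0 hq1, Nat.cast_succ, ← add_assoc,
      Real.Gamma_add_one (s := σ + n) (by positivity)]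
    field_simp
    ring
  · have h1 := tendsto_pow_atTop_nhds_zero_of_lt_one hq0.le hq1
    have h2 := tendsto_self_mul_const_pow_of_lt_one hq0.le hq1
    have h3 := (((h1.const_mul σ).add h2).mul_const (q * ρ)).div
      (tendsto_one_sub_pow_succ hq0 hq1) one_ne_zero
    simpa [Pi.div_def] using h3

theorem summable_norm_qCoef_mul_pow {q ρ : ℝ} (hq0 : 0 < q) (hq1 : q < 1) (hρ : 0 < ρ) :
    Summable fun n : ℕ => ‖qCoef q n‖ * ρ ^ n := by
  refine (summable_norm_qCoef_mul_Gamma hq0 hq1 one_pos hρ).of_nonneg_of_le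
    (fun n => by positivity) fun n => ?_
  rw [add_comm, Real.Gamma_nat_eq_factorial]
  have : (1 : ℝ) ≤ n.factorial := by exact_mod_cast n.factorial_pos
  gcongr
  exact le_mul_of_one_le_left (by positivity) this

theorem summable_norm_pow_div_qPoch {q : ℝ} (hq0 : 0 < q) (hq1 : q < 1) {z : ℂ} (hz : ‖z‖ < 1) :
    Summable fun n : ℕ => ‖1 / qPoch q q n‖ * ‖z‖ ^ n := by
  refine summable_of_tendsto_ratio (l := ‖z‖) (c := fun n : ℕ => ‖z‖ / (1 - q ^ (n + 1)))
    (fun n => by positivity) hz (fun n => ?_) ?_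
  · have h1 := (one_sub_pow_succ_pos hq0 hq1 n).ne'
    have h2 := norm_ne_zero_iff.2 (qPoch_self_ne_zero hq0 hq1 n)
    rw [qPoch_self_succ, norm_div, norm_div, norm_mul, norm_one_sub_pow_succ hq0 hq1]
    field_simp
    ring
  · simpa [Pi.div_def] using (tendsto_const_nhds (x := ‖z‖)).div (tendsto_one_sub_pow_succ hq0 hq1) one_ne_zero

/-- A power series evaluated along `z q ^ N` tends to its constant coefficient. -/
theorem tendsto_tsum_mul_pow {q : ℝ} (hq0 : 0 < q) (hq1 : q < 1) {b : ℕ → ℂ} {z : ℂ}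
    (hb : Summable fun n => ‖b n‖ * ‖z‖ ^ n) :
    Filter.Tendsto (fun N : ℕ => ∑' n, b n * (z * (q : ℂ) ^ N) ^ n) Filter.atTop
      (nhds (b 0)) := by
  have h0 : b 0 = ∑' n, b n * (0 : ℂ) ^ n := by
    rw [tsum_eq_single 0 fun n hn => by simp [hn]]
    simp
  rw [h0]
  refine tendsto_tsum_of_dominated_convergence hb (fun n => ?_)
    (Filter.Eventually.of_forall fun N n => ?_)
  · have hqn : ‖(q : ℂ)‖ < 1 := by rwa [Complex.norm_real, Real.norm_of_nonneg hq0.le]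
    have h1 := (tendsto_pow_atTop_nhds_zero_of_norm_lt_one hqn).const_mul z
    rw [mul_zero] at h1
    exact (h1.pow n).const_mul (b n)
  · rw [norm_mul, norm_pow, norm_mul, norm_pow, Complex.norm_real, Real.norm_of_nonneg hq0.le]
    have : ‖z‖ * q ^ N ≤ ‖z‖ := mul_le_of_le_one_right (norm_nonneg _) (pow_le_one₀ hq0.le hq1.le)
    gcongr

/-- Euler's series `∑ q ^ (n (n + 1) / 2) (-z) ^ n / (q; q)_n`, with sum `(z q; q)_∞`. -/
noncomputable def eulerEntire (q : ℝ) (z : ℂ) : ℂ := ∑' n : ℕ, qCoef q n * (-z) ^ n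

/-- Euler's series `∑ z ^ n / (q; q)_n`, with sum `1 / (z; q)_∞`. -/
noncomputable def eulerSeries (q : ℝ) (z : ℂ) : ℂ := ∑' n : ℕ, 1 / qPoch q q n * z ^ n

theorem summable_eulerEntire {q : ℝ} (hq0 : 0 < q) (hq1 : q < 1) (z : ℂ) :
    Summable fun n : ℕ => qCoef q n * z ^ n := by
  refine .of_norm_bounded (summable_norm_qCoef_mul_pow hq0 hq1 (ρ := ‖z‖ + 1) (by positivity))
    fun n => ?_
  rw [norm_mul, norm_pow]
  gcongr
  linarith

theorem eulerEntire_eq_mul {q : ℝ} (hq0 : 0 < q) (hq1 : q < 1) (z : ℂ) :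
    eulerEntire q z = (1 - z * q) * eulerEntire q (z * q) := by
  have h1 := summable_eulerEntire hq0 hq1 (-z)
  have h2 := summable_eulerEntire hq0 hq1 (-(z * q))
  have h3 : eulerEntire q z - eulerEntire q (z * q) = -(z * q) * eulerEntire q (z * q) := by
    rw [eulerEntire, eulerEntire, ← h1.tsum_sub h2, (h1.sub h2).tsum_eq_zero_add, ← tsum_mul_left]
    simp only [pow_zero, sub_self, zero_add]
    refine tsum_congr fun n => ?_
    have := qCoef_succ hq0 hq1 n
    rw [← neg_mul, mul_pow]
    linear_combination (-z) ^ (n + 1) * this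
  linear_combination h3

theorem eulerEntire_one {q : ℝ} (hq0 : 0 < q) (hq1 : q < 1) : eulerEntire q 1 = qPochInf q q := by
  have h : ∀ N : ℕ, eulerEntire q 1 = qPoch q q N * eulerEntire q ((q : ℂ) ^ N) := by
    intro N
    induction N with
    | zero => simp [qPoch_zero]
    | succ N ih => rw [ih, eulerEntire_eq_mul hq0 hq1, qPoch_self_succ, ← pow_succ]; ring
  have h1 : Summable fun n => ‖qCoef q n‖ * ‖(-1 : ℂ)‖ ^ n := by
    simpa using summable_norm_qCoef_mul_pow hq0 hq1 one_pos
  have h2 := (tendsto_qPoch q hq0 hq1).mul (tendsto_tsum_mul_pow hq0 hq1 h1)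
  rw [qCoef_zero, mul_one] at h2
  refine tendsto_nhds_unique (tendsto_const_nhds.congr fun N => ?_) h2
  rw [h N, eulerEntire]
  simp

theorem eulerEntire_pow {q : ℝ} (hq0 : 0 < q) (hq1 : q < 1) (k : ℕ) :
    qPoch q q k * eulerEntire q ((q : ℂ) ^ k) = qPochInf q q := by
  rw [← eulerEntire_one hq0 hq1]
  induction k with
  | zero => simp [qPoch_zero]
  | succ N ih => rw [← ih, eulerEntire_eq_mul hq0 hq1 (q ^ N), qPoch_self_succ, ← pow_succ]; ring

/-- The factor 1 - zq vanishes at z = q^{-1}, and the functional equation carries this zero to every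
q^{-(k+1)}. These zeros allow sums over k ≥ 0 to be extended to all integers. -/
theorem eulerEntire_inv_pow {q : ℝ} (hq0 : 0 < q) (hq1 : q < 1) (k : ℕ) :
    eulerEntire q (((q : ℂ) ^ (k + 1))⁻¹) = 0 := by
  have h0 : (q : ℂ) ≠ 0 := Complex.ofReal_ne_zero.2 hq0.ne'
  induction k with
  | zero => rw [eulerEntire_eq_mul hq0 hq1]; simp [h0]
  | succ N ih =>
    rw [eulerEntire_eq_mul hq0 hq1, pow_succ _ (N + 1), mul_inv, inv_mul_cancel_right₀ h0, ih,
      mul_zero]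

theorem summable_eulerSeries {q : ℝ} (hq0 : 0 < q) (hq1 : q < 1) {z : ℂ} (hz : ‖z‖ < 1) :
    Summable fun n : ℕ => 1 / qPoch q q n * z ^ n :=
  .of_norm_bounded (summable_norm_pow_div_qPoch hq0 hq1 hz) fun n => by rw [norm_mul, norm_pow]

theorem norm_mul_ofReal_lt_one {q : ℝ} (hq0 : 0 < q) (hq1 : q < 1) {z : ℂ} (hz : ‖z‖ < 1) :
    ‖z * q‖ < 1 := by
  rw [norm_mul, Complex.norm_real, Real.norm_of_nonneg hq0.le]
  exact (mul_le_of_le_one_right (norm_nonneg _) hq1.le).trans_lt hz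

theorem eulerSeries_mul_right {q : ℝ} (hq0 : 0 < q) (hq1 : q < 1) {z : ℂ} (hz : ‖z‖ < 1) :
    eulerSeries q (z * q) = (1 - z) * eulerSeries q z := by
  have h1 := summable_eulerSeries hq0 hq1 hz
  have h2 := summable_eulerSeries hq0 hq1 (norm_mul_ofReal_lt_one hq0 hq1 hz)
  have h3 : eulerSeries q z - eulerSeries q (z * q) = z * eulerSeries q z := by
    rw [eulerSeries, eulerSeries, ← h1.tsum_sub h2, (h1.sub h2).tsum_eq_zero_add, ← tsum_mul_left]
    simp only [pow_zero, sub_self, zero_add]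
    refine tsum_congr fun n => ?_
    have h4 := one_sub_pow_succ_ne_zero hq0 hq1 n
    have h5 := qPoch_self_ne_zero hq0 hq1 n
    rw [mul_pow, qPoch_self_succ]
    field_simp
    ring
  linear_combination -h3

theorem eulerSeries_mul_pow {q : ℝ} (hq0 : 0 < q) (hq1 : q < 1) {z : ℂ} (hz : ‖z‖ < 1) (N : ℕ) :
    eulerSeries q (z * (q : ℂ) ^ N) = qPoch z q N * eulerSeries q z ∧ ‖z * (q : ℂ) ^ N‖ < 1 := by
  induction N with
  | zero => simpa [qPoch_zero] using hz
  | succ N ih =>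
    rw [pow_succ, ← mul_assoc]
    refine ⟨?_, norm_mul_ofReal_lt_one hq0 hq1 ih.2⟩
    rw [eulerSeries_mul_right hq0 hq1 ih.2, ih.1, qPoch_succ]
    ring

/-- Iterating the functional equation gives (z;q)_N times the series at z as the series at z q^N,
which tends to its constant term 1. -/
theorem qPochInf_mul_eulerSeries {q : ℝ} (hq0 : 0 < q) (hq1 : q < 1) {z : ℂ} (hz : ‖z‖ < 1) :
    qPochInf z q * eulerSeries q z = 1 := by
  have h1 := tendsto_tsum_mul_pow hq0 hq1 (summable_norm_pow_div_qPoch hq0 hq1 hz)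
  rw [qPoch_zero, div_one] at h1
  refine tendsto_nhds_unique (((tendsto_qPoch z hq0 hq1).mul_const _).congr fun N => ?_) h1
  rw [← (eulerSeries_mul_pow hq0 hq1 hz N).1, eulerSeries]

theorem qPoch_eq_qPochInf_mul {q : ℝ} (hq0 : 0 < q) (hq1 : q < 1) {z : ℂ} (hz : ‖z‖ < 1) (N : ℕ) :
    qPoch z q N = qPochInf z q * eulerSeries q (z * (q : ℂ) ^ N) := by
  rw [(eulerSeries_mul_pow hq0 hq1 hz N).1]
  linear_combination -(qPoch z q N) * qPochInf_mul_eulerSeries hq0 hq1 hz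

theorem qPochInf_self_ne_zero {q : ℝ} (hq0 : 0 < q) (hq1 : q < 1) : qPochInf q q ≠ 0 :=
  left_ne_zero_of_mul_eq_one (qPochInf_mul_eulerSeries hq0 hq1
    (by rwa [Complex.norm_real, Real.norm_of_nonneg hq0.le]))

theorem qPochInf_eq_mul {q : ℝ} (hq0 : 0 < q) (hq1 : q < 1) (a : ℂ) :
    qPochInf a q = (1 - a) * qPochInf (a * q) q := by
  refine tendsto_nhds_unique ((Filter.tendsto_add_atTop_iff_nat 1).2 (tendsto_qPoch a hq0 hq1)) ?_
  simpa only [qPoch_succ'] using (tendsto_qPoch (a * q) hq0 hq1).const_mul (1 - a)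

/-! ### F as a series of exponentials -/

/-- For `|a| < 1` the function `∑ (a; q)_n / n! (-x) ^ n` is a series of exponentials. -/
theorem pantographF_eq_tsum_exp {q : ℝ} (hq0 : 0 < q) (hq1 : q < 1) {μ : ℂ}
    (hμ : ‖(q : ℂ) ^ μ‖ < 1) (x : ℂ) :
    pantographF μ q x = qPochInf ((q : ℂ) ^ μ) q *
      ∑' k : ℕ, ((q : ℂ) ^ μ) ^ k / qPoch q q k * Complex.exp (-(x * (q : ℂ) ^ k)) := by
  set a : ℂ := (q : ℂ) ^ μ
  let f : ℕ → ℕ → ℂ := fun n k => (1 / qPoch q q k * (a * (q : ℂ) ^ n) ^ k) *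
    ((-x) ^ n / n.factorial)
  have hf : Summable (Function.uncurry f) := by
    refine .of_norm_bounded (((Real.summable_pow_div_factorial ‖x‖).mul_of_nonneg
      (summable_norm_pow_div_qPoch hq0 hq1 hμ) (fun n => by positivity) fun k => by positivity))
      fun p => ?_
    have h1 : ‖a‖ * q ^ p.1 ≤ ‖a‖ := mul_le_of_le_one_right (norm_nonneg _)
      (pow_le_one₀ hq0.le hq1.le)
    simp only [Function.uncurry, f, norm_mul, norm_pow, norm_neg, Complex.norm_real, norm_div,
      Real.norm_of_nonneg hq0.le, Complex.norm_natCast]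
    rw [mul_comm]
    gcongr
  have h1 : pantographF μ q x = qPochInf a q * ∑' n, ∑' k, f n k := by
    rw [pantographF, ← tsum_mul_left]
    refine tsum_congr fun n => ?_
    rw [tsum_mul_right, show qPoch ((q : ℂ) ^ μ) q n = _ from qPoch_eq_qPochInf_mul hq0 hq1 hμ n,
      eulerSeries]
    ring
  rw [h1, ← Summable.tsum_comm (f := f) hf]
  congr 1
  refine tsum_congr fun k => ?_
  -- With k fixed, the factors q^{nk} (-x)^n / n! sum over n to exp(-x q^k).
  have h2 := NormedSpace.expSeries_div_hasSum_exp (-(x * (q : ℂ) ^ k))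
  rw [Complex.exp_eq_exp_ℂ, ← h2.tsum_eq, ← tsum_mul_left]
  refine tsum_congr fun n => ?_
  simp only [f]
  rw [mul_pow, ← neg_mul, mul_pow, ← pow_mul, ← pow_mul, mul_comm k n]
  ring

/-! ### Absolute convergence of the double series -/

theorem summable_pow_natAbs {ρ : ℝ} (h0 : 0 ≤ ρ) (h1 : ρ < 1) :
    Summable fun m : ℤ => ρ ^ m.natAbs :=
  .of_nat_of_neg (by simpa using summable_geometric_of_lt_one h0 h1)
    (by simpa using summable_geometric_of_lt_one h0 h1)

theorem summable_exp_neg_abs {δ κ : ℝ} (hδ : 0 < δ) (hκ : 0 < κ) (b : ℝ) :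
    Summable fun m : ℤ => Real.exp (-(δ * |b + κ * m|)) := by
  have hlt : Real.exp (-(δ * κ)) < 1 := Real.exp_lt_one_iff.2 (by simp; positivity)
  refine ((summable_pow_natAbs (Real.exp_nonneg _) hlt).mul_left
    (Real.exp (δ * |b|))).of_nonneg_of_le (fun m => Real.exp_nonneg _) fun m => ?_
  rw [← Real.exp_nat_mul, ← Real.exp_add, Real.exp_le_exp, Nat.cast_natAbs, Int.cast_abs]
  have h1 : κ * |(m : ℝ)| ≤ |b + κ * m| + |b| := by
    rw [← abs_of_pos hκ, ← abs_mul, abs_of_pos hκ]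
    calc |κ * (m : ℝ)| = |(b + κ * m) - b| := by ring_nf
      _ ≤ _ := abs_sub _ _
  nlinarith

/-- The point `μ + n + κ m i` of the half-lattice attached to `μ`. -/
noncomputable def latticePt (κ : ℝ) (μ : ℂ) (p : ℕ × ℤ) : ℂ := μ + p.1 + κ * p.2 * Complex.I

theorem latticePt_add_one (κ : ℝ) (μ : ℂ) (p : ℕ × ℤ) :
    latticePt κ (μ + 1) p = latticePt κ μ p + 1 := by
  rw [latticePt, latticePt]
  ring

theorem latticePt_re (κ : ℝ) (μ : ℂ) (p : ℕ × ℤ) : (latticePt κ μ p).re = μ.re + p.1 := by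
  simp [latticePt]

theorem latticePt_im (κ : ℝ) (μ : ℂ) (p : ℕ × ℤ) : (latticePt κ μ p).im = μ.im + κ * p.2 := by
  simp [latticePt]

/-- The exponents excluded by the poles of `Γ` at the points of the half-lattice. -/
def IsRegularExponent (κ : ℝ) (μ : ℂ) : Prop :=
  ∀ (m : ℕ) (k : ℤ), μ ≠ -(m : ℂ) + (κ : ℂ) * (k : ℂ) * Complex.I

theorem IsRegularExponent.add_one {κ : ℝ} {μ : ℂ} (h : IsRegularExponent κ μ) :
    IsRegularExponent κ (μ + 1) := fun m k hm => h (m + 1) k <| by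
  push_cast
  linear_combination hm

theorem IsRegularExponent.latticePt_ne_zero {κ : ℝ} {μ : ℂ} (h : IsRegularExponent κ μ)
    (p : ℕ × ℤ) : latticePt κ μ p ≠ 0 := fun hp => h p.1 (-p.2) <| by
  rw [latticePt] at hp
  push_cast
  linear_combination hp

theorem finite_norm_latticePt_lt_one {κ : ℝ} (hκ : 0 < κ) (μ : ℂ) :
    {p : ℕ × ℤ | ‖latticePt κ μ p‖ < 1}.Finite := by
  refine ((Set.finite_Iic ⌈1 + |μ.re|⌉₊).prod (Set.finite_Icc (-⌈(1 + |μ.im|) / κ⌉)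
    ⌈(1 + |μ.im|) / κ⌉)).subset fun p (hp : ‖latticePt κ μ p‖ < 1) => ?_
  have hre := (Complex.abs_re_le_norm _).trans hp.le
  have him := (Complex.abs_im_le_norm _).trans hp.le
  rw [latticePt_re, abs_le] at hre
  rw [latticePt_im, abs_le] at him
  have h1 := neg_abs_le μ.re
  have h2 := abs_le.1 (le_refl |μ.im|)
  refine ⟨?_, ?_, ?_⟩
  · have : (p.1 : ℝ) ≤ (⌈1 + |μ.re|⌉₊ : ℝ) := le_trans (by linarith) (Nat.le_ceil _)
    exact_mod_cast this
  · have : -(p.2 : ℝ) ≤ (⌈(1 + |μ.im|) / κ⌉ : ℝ) :=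
      le_trans ((le_div_iff₀ hκ).2 (by linarith)) (Int.le_ceil _)
    have h3 : -p.2 ≤ ⌈(1 + |μ.im|) / κ⌉ := by exact_mod_cast this
    linarith
  · have : (p.2 : ℝ) ≤ (⌈(1 + |μ.im|) / κ⌉ : ℝ) :=
      le_trans ((le_div_iff₀ hκ).2 (by linarith)) (Int.le_ceil _)
    exact_mod_cast this

/-- Only finitely many lattice points lie in the unit disc and none is zero. The uniform bound
permits division by s over the whole half-lattice. -/
theorem IsRegularExponent.exists_pos_le_norm_latticePt {κ : ℝ} (hκ : 0 < κ) {μ : ℂ}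
    (h : IsRegularExponent κ μ) : ∃ ε > 0, ∀ p, ε ≤ ‖latticePt κ μ p‖ := by
  have h1 : ∀ᶠ ε : ℝ in nhdsWithin 0 (Set.Ioi 0), ∀ p ∈ {p : ℕ × ℤ | ‖latticePt κ μ p‖ < 1},
      ε ≤ ‖latticePt κ μ p‖ := by
    refine (Filter.eventually_all_finite (finite_norm_latticePt_lt_one hκ μ)).2 fun p _ => ?_
    exact nhdsWithin_le_nhds (ge_mem_nhds (norm_pos_iff.2 (h.latticePt_ne_zero p)))
  have h2 : ∀ᶠ ε : ℝ in nhdsWithin 0 (Set.Ioi 0), ε ≤ 1 :=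
    nhdsWithin_le_nhds (ge_mem_nhds one_pos)
  obtain ⟨ε, ⟨hε1, hε2⟩, hε0⟩ := ((h1.and h2).and self_mem_nhdsWithin).exists
  refine ⟨ε, hε0, fun p => ?_⟩
  by_cases hp : ‖latticePt κ μ p‖ < 1
  · exact hε1 p hp
  · exact hε2.trans (not_lt.1 hp)

/-- The terms of the double series obtained by expanding `Ψ` in the transformation formula. -/
noncomputable def modularTerm (q : ℝ) (μ x : ℂ) (p : ℕ × ℤ) : ℂ :=
  (-1) ^ p.1 * qCoef q p.1 * gammaPow (latticePt (qKappa q) μ p) x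

theorem norm_modularTerm (q : ℝ) (μ x : ℂ) (p : ℕ × ℤ) :
    ‖modularTerm q μ x p‖ = ‖qCoef q p.1‖ * ‖gammaPow (latticePt (qKappa q) μ p) x‖ := by
  simp [modularTerm]

theorem qKappa_pos {q : ℝ} (hq0 : 0 < q) (hq1 : q < 1) : 0 < qKappa q :=
  div_pos_of_neg_of_neg (by linarith [Real.pi_pos]) (Real.log_neg hq0 hq1)

/-- At δ = 0 the right side is r > r/2, so continuity suffices. The angle depends on r and R alone,
hence is uniform in x and in the lattice point. -/
theorem exists_rotation_angle {r : ℝ} (hr : 0 < r) (R : ℝ) :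
    ∃ δ : ℝ, 0 < δ ∧ δ < Real.pi / 2 ∧ r / 2 ≤ r * Real.cos δ - R * Real.sin δ := by
  have hc : Filter.Tendsto (fun δ : ℝ => r * Real.cos δ - R * Real.sin δ) (nhds 0)
      (nhds (r * Real.cos 0 - R * Real.sin 0)) := Continuous.tendsto (by fun_prop) 0
  have h1 : ∀ᶠ δ : ℝ in nhdsWithin 0 (Set.Ioi 0), r / 2 ≤ r * Real.cos δ - R * Real.sin δ :=
    nhdsWithin_le_nhds (hc.eventually (le_mem_nhds (by simp; linarith)))
  have h2 : ∀ᶠ δ : ℝ in nhdsWithin 0 (Set.Ioi 0), δ < Real.pi / 2 :=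
    nhdsWithin_le_nhds (gt_mem_nhds (by positivity))
  obtain ⟨δ, ⟨h1, h2⟩, h3⟩ := ((h1.and h2).and self_mem_nhdsWithin).exists
  exact ⟨δ, h3, h2, h1⟩

theorem exists_summable_bound_of_re_pos {q : ℝ} (hq0 : 0 < q) (hq1 : q < 1) {μ : ℂ}
    (hμ : 0 < μ.re) {r R : ℝ} (hr : 0 < r) :
    ∃ u : ℕ × ℤ → ℝ, Summable u ∧
      ∀ p x, r ≤ x.re → ‖x‖ ≤ R → ‖modularTerm q μ x p‖ ≤ u p := by
  obtain ⟨δ, hδ0, hδ, hrot⟩ := exists_rotation_angle hr R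
  have hr2 : 0 < 1 / (r / 2) := by positivity
  have h1 := (summable_norm_qCoef_mul_Gamma hq0 hq1 hμ hr2).mul_right ((1 / (r / 2)) ^ μ.re)
  have h2 := summable_exp_neg_abs hδ0 (qKappa_pos hq0 hq1) μ.im
  refine ⟨_, h1.mul_of_nonneg h2 (fun n => ?_) fun m => Real.exp_nonneg _, fun p x hx hxR => ?_⟩
  · have := Real.Gamma_pos_of_pos (s := μ.re + n) (by positivity)
    positivity
  · have h := norm_gammaPow_le_exp (s := latticePt (qKappa q) μ p)
      (by rw [latticePt_re]; positivity) hx hxR hδ0.le hδ (half_pos hr) hrot hr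
    rw [latticePt_re, latticePt_im, Real.rpow_add hr2, Real.rpow_natCast] at h
    rw [norm_modularTerm]
    refine (mul_le_mul_of_nonneg_left h (norm_nonneg _)).trans_eq ?_
    ring

/-- The double series converges absolutely, locally uniformly in the right half-plane. -/
theorem exists_summable_bound {q : ℝ} (hq0 : 0 < q) (hq1 : q < 1) {r R : ℝ} (hr : 0 < r)
    {μ : ℂ} (hμ : IsRegularExponent (qKappa q) μ) :
    ∃ u : ℕ × ℤ → ℝ, Summable u ∧
      ∀ p x, r ≤ x.re → ‖x‖ ≤ R → ‖modularTerm q μ x p‖ ≤ u p := by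
  -- Induction on the number of unit shifts that bring Re μ above 0. By Γ(s) = Γ(s+1)/s, a term for
  -- μ is x/s times the term for μ + 1, with |x| ≤ R and |s| ≥ ε.
  obtain ⟨N, hN⟩ := exists_nat_gt (-μ.re)
  induction N generalizing μ with
  | zero => exact exists_summable_bound_of_re_pos hq0 hq1 (by simpa using hN) hr
  | succ N ih =>
    obtain ⟨u, hu, hb⟩ := ih hμ.add_one (by push_cast at hN; simp; linarith)
    obtain ⟨ε, hε, hεp⟩ := hμ.exists_pos_le_norm_latticePt (qKappa_pos hq0 hq1)
    refine ⟨_, hu.mul_left (R / ε), fun p x hx hxR => ?_⟩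
    have hx0 : x ≠ 0 := by rintro rfl; simp at hx; linarith
    have h1 := gammaPow_add_one (hμ.latticePt_ne_zero p) hx0
    have h2 := hb p x hx hxR
    rw [norm_modularTerm, latticePt_add_one, h1, norm_mul, norm_div] at h2
    rw [norm_modularTerm]
    have hR : 0 ≤ R := (norm_nonneg x).trans hxR
    have hxn : 0 < ‖x‖ := norm_pos_iff.2 hx0
    set c := ‖qCoef q p.1‖
    set g := ‖gammaPow (latticePt (qKappa q) μ p) x‖
    calc c * g ≤ ‖latticePt (qKappa q) μ p‖ / ε * (c * g) :=
          le_mul_of_one_le_left (by positivity) ((one_le_div hε).2 (hεp p))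
      _ = ‖x‖ / ε * (c * (‖latticePt (qKappa q) μ p‖ / ‖x‖ * g)) := by field_simp
      _ ≤ R / ε * u p := by gcongr

theorem summable_modularTerm {q : ℝ} (hq0 : 0 < q) (hq1 : q < 1)
    {μ : ℂ} (hμ : IsRegularExponent (qKappa q) μ) {x : ℂ} (hx : 0 < x.re) :
    Summable (modularTerm q μ x) := by
  obtain ⟨u, hu, hb⟩ := exists_summable_bound hq0 hq1 (R := ‖x‖) hx hμ
  exact .of_norm_bounded hu fun p => hb p x le_rfl le_rfl

/-! ### Derivative and q-difference equation of the double series -/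

theorem hasDerivAt_tsum_modularTerm {q : ℝ} (hq0 : 0 < q) (hq1 : q < 1)
    {μ : ℂ} (hμ : IsRegularExponent (qKappa q) μ) {x : ℂ} (hx : 0 < x.re) :
    HasDerivAt (fun x => ∑' p, modularTerm q μ x p) (-∑' p, modularTerm q (μ + 1) x p) x := by
  obtain ⟨u, hu, hb⟩ := exists_summable_bound hq0 hq1 (R := ‖x‖ + 1) (half_pos hx) hμ
  let U : Set ℂ := {z | x.re / 2 < z.re} ∩ {z | ‖z‖ < ‖x‖ + 1}
  have hU : IsOpen U := (isOpen_lt continuous_const Complex.continuous_re).inter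
    (isOpen_lt continuous_norm continuous_const)
  have hxU : x ∈ U := ⟨by simp; linarith, by simp⟩
  have hd : ∀ p, ∀ z : ℂ, 0 < z.re →
      HasDerivAt (fun x => modularTerm q μ x p) (-modularTerm q (μ + 1) z p) z := fun p z hz => by
    have := (hasDerivAt_gammaPow (hμ.latticePt_ne_zero p) hz).const_mul ((-1) ^ p.1 * qCoef q p.1)
    refine this.congr_deriv ?_
    rw [modularTerm, latticePt_add_one]
    ring
  have hpos : ∀ z ∈ U, 0 < z.re := fun z hz => (half_pos hx).trans hz.1
  have hdiff : ∀ p, DifferentiableOn ℂ (fun x => modularTerm q μ x p) U := fun p z hz =>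
    (hd p z (hpos z hz)).differentiableAt.differentiableWithinAt
  have hbound : ∀ p, ∀ z ∈ U, ‖modularTerm q μ z p‖ ≤ u p := fun p z hz =>
    hb p z (le_of_lt hz.1) (le_of_lt hz.2)
  have h1 := (Complex.hasSum_deriv_of_summable_norm hu hdiff hU hbound hxU).tsum_eq
  have h2 := ((Complex.differentiableOn_tsum_of_summable_norm hu hdiff hU hbound).differentiableAt
    (hU.mem_nhds hxU)).hasDerivAt
  rw [← h1] at h2
  refine h2.congr_deriv ?_
  rw [← tsum_neg]
  exact tsum_congr fun p => (hd p x hx).deriv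

theorem log_ofReal_mul_eq {q : ℝ} (hq0 : 0 < q) {x : ℂ} (hx : x ≠ 0) :
    Complex.log (q * x) = Complex.log q + Complex.log x := by
  rw [Complex.log_ofReal_mul hq0 hx, Complex.ofReal_log hq0.le]

/-- The choice of κ makes κ ln q = -2π, so the imaginary shift κmi contributes exp(-2πim) = 1. -/
theorem exp_latticePt_mul_log {q : ℝ} (hq0 : 0 < q) (hq1 : q < 1) (μ : ℂ) (p : ℕ × ℤ) :
    Complex.exp (latticePt (qKappa q) μ p * Complex.log q) = (q : ℂ) ^ μ * (q : ℂ) ^ p.1 := by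
  have h0 : (q : ℂ) ≠ 0 := Complex.ofReal_ne_zero.2 hq0.ne'
  have hl : Complex.log q ≠ 0 := by
    rw [← Complex.ofReal_log hq0.le]
    exact Complex.ofReal_ne_zero.2 (Real.log_neg hq0 hq1).ne
  have h1 : latticePt (qKappa q) μ p * Complex.log q =
      Complex.log q * μ + Complex.log q * (p.1 : ℂ) + (-p.2 : ℤ) * (2 * Real.pi * Complex.I) := by
    rw [latticePt, qKappa]
    push_cast
    rw [Complex.ofReal_log hq0.le]
    field_simp
  rw [h1, Complex.exp_add, Complex.exp_int_mul_two_pi_mul_I, Complex.exp_add,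
    ← Complex.cpow_def_of_ne_zero h0, ← Complex.cpow_def_of_ne_zero h0, Complex.cpow_natCast,
    mul_one]

theorem gammaPow_latticePt_mul {q : ℝ} (hq0 : 0 < q) (hq1 : q < 1) (μ : ℂ) (p : ℕ × ℤ)
    {x : ℂ} (hx : x ≠ 0) :
    (q : ℂ) ^ μ * (q : ℂ) ^ p.1 * gammaPow (latticePt (qKappa q) μ p) (q * x) =
      gammaPow (latticePt (qKappa q) μ p) x := by
  rw [← exp_latticePt_mul_log hq0 hq1, gammaPow, gammaPow, log_ofReal_mul_eq hq0 hx,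
    mul_left_comm, ← Complex.exp_add]
  ring_nf

/-- The combination multiplies row n by 1 - q^{-n}. Row 0 disappears, and the recursion for `qCoef`
turns row n + 1 for μ into row n for μ + 1. -/
theorem tsum_modularTerm_qdiff {q : ℝ} (hq0 : 0 < q) (hq1 : q < 1)
    {μ : ℂ} (hμ : IsRegularExponent (qKappa q) μ) {x : ℂ} (hx : 0 < x.re) :
    ∑' p, modularTerm q μ x p - (q : ℂ) ^ μ * ∑' p, modularTerm q μ (q * x) p =
      ∑' p, modularTerm q (μ + 1) x p := by
  have h0 : (q : ℂ) ≠ 0 := Complex.ofReal_ne_zero.2 hq0.ne'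
  have hx0 : x ≠ 0 := by rintro rfl; simp at hx
  have hqx : 0 < ((q : ℂ) * x).re := by simpa using mul_pos hq0 hx
  have h1 := summable_modularTerm hq0 hq1 hμ hx
  have h2 := (summable_modularTerm hq0 hq1 hμ hqx).mul_left ((q : ℂ) ^ μ)
  rw [← tsum_mul_left, ← h1.tsum_sub h2]
  have hinj : Function.Injective (fun p : ℕ × ℤ => (p.1 + 1, p.2)) := by
    rintro ⟨a, b⟩ ⟨c, d⟩ h
    simpa using h
  rw [← hinj.tsum_eq]
  · refine tsum_congr fun p => ?_
    have h3 := gammaPow_latticePt_mul hq0 hq1 μ (p.1 + 1, p.2) hx0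
    have h4 : latticePt (qKappa q) μ (p.1 + 1, p.2) = latticePt (qKappa q) (μ + 1) p := by
      rw [latticePt, latticePt]
      push_cast
      ring
    have h5 := qCoef_succ hq0 hq1 p.1
    have hq : (q : ℂ) ^ (p.1 + 1) ≠ 0 := pow_ne_zero _ h0
    simp only [modularTerm]
    simp only [h4] at h3 ⊢
    refine mul_right_cancel₀ hq ?_
    linear_combination (-(-1) ^ (p.1 + 1) * qCoef q (p.1 + 1)) * h3 +
      (-1) ^ p.1 * gammaPow (latticePt (qKappa q) (μ + 1) p) x * h5
  · rintro ⟨n, m⟩ hp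
    cases n with
    | zero =>
      refine absurd ?_ hp
      have h3 := gammaPow_latticePt_mul hq0 hq1 μ (0, m) hx0
      simp only [modularTerm]
      simp only [pow_zero, mul_one, one_mul] at h3 ⊢
      linear_combination -(qCoef q 0) * h3
    | succ n => exact ⟨(n, m), rfl⟩

/-! ### Poisson summation -/

/-- The summand `q ^ (u s) exp (-x q ^ u)` at a real point `u`. -/
noncomputable def expTerm (q : ℝ) (s x : ℂ) (u : ℝ) : ℂ :=
  Complex.exp (s * (u * Real.log q : ℝ)) * Complex.exp (-(x * (Real.exp (u * Real.log q) : ℝ)))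

/-- For v ≤ 0 the decay comes from p ≥ 1; for v ≥ 0 from y^M ≤ M! e^y at y = r e^v. The explicit M!
is needed later, when M grows with the row index. -/
theorem exp_mul_exp_neg_le {p r : ℝ} {M : ℕ} (hr : 0 < r) (hp : 1 ≤ p) (hM : p + 1 ≤ M) (v : ℝ) :
    Real.exp (p * v) * Real.exp (-(r * Real.exp v)) ≤
      (1 + M.factorial * (1 / r) ^ M) * Real.exp (-|v|) := by
  have hpos : 0 ≤ (M.factorial : ℝ) * (1 / r) ^ M := by positivity
  have hexp := Real.exp_pos (-|v|)
  rcases le_total v 0 with hv | hv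
  · have h1 : Real.exp (p * v) ≤ Real.exp (-|v|) := by
      rw [abs_of_nonpos hv, neg_neg, Real.exp_le_exp]
      nlinarith
    have h2 : Real.exp (-(r * Real.exp v)) ≤ 1 := Real.exp_le_one_iff.2 (by simp; positivity)
    nlinarith [Real.exp_pos (p * v)]
  · have h1 : (r * Real.exp v) ^ M ≤ M.factorial * Real.exp (r * Real.exp v) := by
      have := Real.pow_div_factorial_le_exp (x := r * Real.exp v) (by positivity) M
      rwa [div_le_iff₀' (by positivity)] at this
    have h2 : Real.exp (p * v) ≤ Real.exp v ^ M * Real.exp (-|v|) := by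
      rw [abs_of_nonneg hv, ← Real.exp_nat_mul, ← Real.exp_add, Real.exp_le_exp]
      nlinarith
    calc Real.exp (p * v) * Real.exp (-(r * Real.exp v))
        ≤ (Real.exp v ^ M * Real.exp (-|v|)) * Real.exp (-(r * Real.exp v)) := by gcongr
      _ = (r * Real.exp v) ^ M * ((1 / r) ^ M * Real.exp (-|v|) *
            Real.exp (-(r * Real.exp v))) := by
          rw [mul_pow, one_div, inv_pow]
          field_simp
      _ ≤ (M.factorial * Real.exp (r * Real.exp v)) * ((1 / r) ^ M * Real.exp (-|v|) *
            Real.exp (-(r * Real.exp v))) := by gcongr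
      _ = M.factorial * (1 / r) ^ M * Real.exp (-|v|) := by
          rw [Real.exp_neg (r * Real.exp v)]
          field_simp
      _ ≤ _ := by nlinarith

theorem norm_expTerm_le {q : ℝ} {s x : ℂ} {M : ℕ} (hx : 0 < x.re) (hs : 1 ≤ s.re)
    (hM : s.re + 1 ≤ M) (u : ℝ) :
    ‖expTerm q s x u‖ ≤
      (1 + M.factorial * (1 / x.re) ^ M) * Real.exp (-|u * Real.log q|) := by
  refine le_trans (le_of_eq ?_) (exp_mul_exp_neg_le hx hs hM (u * Real.log q))
  rw [expTerm, norm_mul, Complex.norm_exp, Complex.norm_exp, Complex.re_mul_ofReal, Complex.neg_re,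
    Complex.re_mul_ofReal]

open scoped FourierTransform in
-- The substitution t = q^u turns the Fourier integral at frequency m into the Mellin integral of
-- exp(-xt) at s + κmi, which is Euler's integral.
theorem fourier_expTerm {q : ℝ} (hq0 : 0 < q) (hq1 : q < 1) {s x : ℂ} (hs : 0 < s.re)
    (hx : 0 < x.re) (m : ℤ) :
    𝓕 (expTerm q s x) (m : ℝ) =
      (qKappa q : ℂ) / (2 * Real.pi) * gammaPow (s + qKappa q * m * Complex.I) x := by
  have hl := Real.log_neg hq0 hq1
  set L : ℝ := -Real.log q with hL
  have hL0 : 0 < L := by linarith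
  have hLc : (L : ℂ) ≠ 0 := Complex.ofReal_ne_zero.2 hL0.ne'
  have hpi : (Real.pi : ℂ) ≠ 0 := Complex.ofReal_ne_zero.2 Real.pi_ne_zero
  have hκ : (qKappa q : ℂ) = 2 * Real.pi / L := by
    rw [qKappa, neg_div, ← div_neg, ← hL]
    push_cast
    rfl
  let g : ℝ → ℂ := fun t => Complex.exp (-(x * t))
  -- The Mellin–Fourier dictionary uses t = e^{-u}; inserting t^L with L = -ln q replaces it by q^u.
  -- The Mellin variable 2πim is purely imaginary, so no real exponential weight remains.
  have h1 := mellin_eq_fourier (fun t : ℝ => (t : ℂ) ^ (L * s : ℂ) • g (t ^ L))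
    (s := (2 * Real.pi * m : ℝ) * Complex.I)
  rw [mellin_cpow_smul (fun t : ℝ => g (t ^ L)), mellin_comp_rpow] at h1
  have h2 : (((2 * Real.pi * m : ℝ) * Complex.I) + L * s) / L =
      s + qKappa q * m * Complex.I := by
    rw [hκ]
    push_cast
    field_simp
    ring
  have h3 : mellin g (s + qKappa q * m * Complex.I) =
      gammaPow (s + qKappa q * m * Complex.I) x := by
    rw [mellin, gammaPow, ← integral_cpow_mul_exp_neg_eq_Gamma (by simpa using hs) hx]
    simp [g]
  have h4 : ((((2 * Real.pi * m : ℝ) : ℂ) * Complex.I).im / (2 * Real.pi)) = (m : ℝ) := by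
    rw [Complex.im_ofReal_mul, Complex.I_im]
    field_simp
  have h5 : (fun u : ℝ => (Real.exp (-(((2 * Real.pi * m : ℝ) : ℂ) * Complex.I).re * u) •
      ((Real.exp (-u) : ℂ) ^ (L * s : ℂ) • g (Real.exp (-u) ^ L)))) = expTerm q s x := by
    funext u
    have h6 : Real.exp (-u) ^ L = Real.exp (u * Real.log q) := by
      rw [← Real.exp_mul, hL]
      ring_nf
    have h7 : (Real.exp (-u) : ℂ) ^ (L * s : ℂ) = Complex.exp (s * (u * Real.log q : ℝ)) := by
      rw [Complex.cpow_def_of_ne_zero (Complex.ofReal_ne_zero.2 (Real.exp_pos _).ne'),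
        ← Complex.ofReal_log (Real.exp_pos _).le, Real.log_exp, hL]
      push_cast
      ring_nf
    rw [h6, h7, Complex.re_ofReal_mul, Complex.I_re]
    simp [g, expTerm]
  rw [h2, h3, h4, h5] at h1
  rw [← h1, hκ, abs_of_pos hL0, Complex.real_smul]
  push_cast
  field_simp

theorem continuous_expTerm (q : ℝ) (s x : ℂ) : Continuous (expTerm q s x) := by
  unfold expTerm
  fun_prop

theorem expTerm_isBigO {q : ℝ} (hq0 : 0 < q) (hq1 : q < 1) {s x : ℂ} (hs : 1 ≤ s.re)
    (hx : 0 < x.re) :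
    expTerm q s x =O[Filter.cocompact ℝ] fun u : ℝ => |u| ^ (-2 : ℝ) := by
  obtain ⟨M, hM⟩ := exists_nat_ge (s.re + 1)
  have hl := Real.log_neg hq0 hq1
  -- The factor 2 / (ln q)^2 comes from y^2/2 ≤ e^y at y = |u ln q|.
  refine Asymptotics.IsBigO.of_bound
    ((1 + M.factorial * (1 / x.re) ^ M) * (2 / Real.log q ^ 2)) ?_
  have h0 : ∀ᶠ u : ℝ in Filter.cocompact ℝ, u ≠ 0 :=
    isCompact_singleton.compl_mem_cocompact
  filter_upwards [h0] with u hu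
  refine (norm_expTerm_le hx hs hM u).trans ?_
  rw [mul_assoc]
  have hu' : 0 < |u| := abs_pos.2 hu
  have h1 := Real.quadratic_le_exp_of_nonneg (abs_nonneg (u * Real.log q))
  have h2 : |u * Real.log q| ^ 2 = |u| ^ 2 * Real.log q ^ 2 := by
    rw [abs_mul, mul_pow, sq_abs (Real.log q)]
  have h3 : ‖|u| ^ (-2 : ℝ)‖ = 1 / |u| ^ 2 := by
    rw [Real.norm_of_nonneg (by positivity), Real.rpow_neg hu'.le, one_div]
    norm_num
  rw [h3, Real.exp_neg]
  refine mul_le_mul_of_nonneg_left ?_ (by positivity)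
  have h4 : 0 < |u| ^ 2 * Real.log q ^ 2 := by
    have := sq_pos_of_neg hl
    positivity
  rw [div_mul_div_comm, mul_one, inv_le_comm₀ (Real.exp_pos _) (by rw [mul_comm]; positivity),
    inv_div, mul_comm]
  linarith [abs_nonneg (u * Real.log q)]

/-- Poisson summation for `∑ q ^ (k s) exp (-x q ^ k)`. -/
theorem tsum_expTerm {q : ℝ} (hq0 : 0 < q) (hq1 : q < 1) {s x : ℂ} (hs : 1 ≤ s.re)
    (hx : 0 < x.re) (hsum : Summable fun m : ℤ => gammaPow (s + qKappa q * m * Complex.I) x) :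
    ∑' k : ℤ, expTerm q s x k =
      (qKappa q : ℂ) / (2 * Real.pi) * ∑' m : ℤ, gammaPow (s + qKappa q * m * Complex.I) x := by
  have hF := fourier_expTerm hq0 hq1 (s := s) (x := x) (by linarith) hx
  have h := Real.tsum_eq_tsum_fourier_of_rpow_decay_of_summable (continuous_expTerm q s x)
    one_lt_two (expTerm_isBigO hq0 hq1 hs hx)
    ((hsum.mul_left ((qKappa q : ℂ) / (2 * Real.pi))).congr fun m => (hF m).symm) 0
  simp only [zero_add, hF] at h
  rw [h, ← tsum_mul_left]
  exact tsum_congr fun m => by simp [fourier_apply]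

theorem expTerm_int {q : ℝ} (hq0 : 0 < q) (μ x : ℂ) (n : ℕ) (k : ℤ) :
    expTerm q (μ + n) x k =
      ((q : ℂ) ^ μ) ^ k * ((q : ℂ) ^ k) ^ n * Complex.exp (-(x * (q : ℂ) ^ k)) := by
  have h0 : (q : ℂ) ≠ 0 := Complex.ofReal_ne_zero.2 hq0.ne'
  have h1 : Real.exp (k * Real.log q) = q ^ k := by
    rw [mul_comm, Real.exp_mul, Real.exp_log hq0, Real.rpow_intCast]
  have h2 : Complex.exp (k * Real.log q : ℝ) = (q : ℂ) ^ k := by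
    rw [← Complex.ofReal_exp, h1, Complex.ofReal_zpow]
  have h3 : Complex.exp (μ * (k * Real.log q : ℝ)) = ((q : ℂ) ^ μ) ^ k := by
    rw [Complex.cpow_def_of_ne_zero h0, ← Complex.exp_int_mul, ← Complex.ofReal_log hq0.le]
    push_cast
    ring_nf
  rw [expTerm, h1, add_mul, Complex.exp_add, h3, Complex.exp_nat_mul, h2, Complex.ofReal_zpow]

/-- Row n has exponent μ + n, so the power bound is used with M + n in place of M. The resulting
(M+n)! (1/Re x)^{M+n} is still absorbed by `qCoef`. -/
theorem summable_qCoef_mul_expTerm {q : ℝ} (hq0 : 0 < q) (hq1 : q < 1) {μ x : ℂ} (hμ : 1 ≤ μ.re)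
    (hx : 0 < x.re) :
    Summable fun p : ℕ × ℤ => (-1) ^ p.1 * qCoef q p.1 * expTerm q (μ + p.1) x p.2 := by
  obtain ⟨M, hM⟩ := exists_nat_ge (μ.re + 1)
  have hl := Real.log_neg hq0 hq1
  have hx1 : 0 < 1 / x.re := by positivity
  have h1 := (summable_norm_qCoef_mul_pow hq0 hq1 one_pos).add
    ((summable_norm_qCoef_mul_Gamma hq0 hq1 (σ := M + 1) (by positivity) hx1).mul_right
      ((1 / x.re) ^ M))
  have h2 := summable_exp_neg_abs one_pos (neg_pos.2 hl) 0
  refine .of_norm_bounded (h1.mul_of_nonneg h2 (fun n => ?_) fun m => Real.exp_nonneg _)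
    fun p => ?_
  · have := Real.Gamma_pos_of_pos (s := (M + 1 : ℝ) + n) (by positivity)
    positivity
  · have h3 := norm_expTerm_le (q := q) (s := μ + p.1) (M := M + p.1) hx
      (by simp; linarith [p.1.cast_nonneg (α := ℝ)]) (by simp; linarith) p.2
    have h4 : Real.Gamma ((M + 1 : ℝ) + p.1) = ((M + p.1).factorial : ℝ) := by
      rw [← Real.Gamma_nat_eq_factorial]
      push_cast
      ring_nf
    have h5 : (1 : ℝ) * |0 + -Real.log q * p.2| = |p.2 * Real.log q| := by
      rw [one_mul, zero_add, neg_mul, abs_neg, mul_comm]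
    simp only [norm_mul, norm_pow, norm_neg, norm_one, one_pow, one_mul, h4, h5]
    refine (mul_le_mul_of_nonneg_left h3 (norm_nonneg _)).trans_eq ?_
    rw [pow_add]
    simp only [mul_one]
    ring

/-! ### The formula for Re μ ≥ 1 -/

/-- Negative k fall on zeros of `eulerEntire`; for k ≥ 0 its value at q^k is (q;q)_∞ / (q;q)_k. -/
theorem tsum_eulerEntire_mul {q : ℝ} (hq0 : 0 < q) (hq1 : q < 1) (a x : ℂ) :
    ∑' k : ℤ, eulerEntire q ((q : ℂ) ^ k) * (a ^ k * Complex.exp (-(x * (q : ℂ) ^ k))) =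
      qPochInf q q * ∑' k : ℕ, a ^ k / qPoch q q k * Complex.exp (-(x * (q : ℂ) ^ k)) := by
  rw [← (Nat.cast_injective (R := ℤ)).tsum_eq, ← tsum_mul_left]
  · refine tsum_congr fun k => ?_
    simp only [zpow_natCast]
    rw [← eulerEntire_pow hq0 hq1 k]
    have := qPoch_self_ne_zero hq0 hq1 k
    field_simp
  · intro k hk
    by_contra h
    have hneg : k < 0 := not_le.1 fun h0 => h ⟨k.toNat, Int.toNat_of_nonneg h0⟩
    obtain ⟨n, rfl⟩ := Int.eq_negSucc_of_lt_zero hneg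
    apply hk
    simp only
    rw [zpow_negSucc, eulerEntire_inv_pow hq0 hq1, zero_mul]

/-- Poisson summation is applied to each row n. After the double sum is exchanged, the sum over n at
fixed k is Euler's series at q^k. -/
theorem tsum_modularTerm_of_one_le_re {q : ℝ} (hq0 : 0 < q) (hq1 : q < 1) {μ x : ℂ}
    (hreg : IsRegularExponent (qKappa q) μ) (hμ : 1 ≤ μ.re) (hx : 0 < x.re) :
    (qKappa q : ℂ) / (2 * Real.pi) * ∑' p, modularTerm q μ x p =
      qPochInf q q *
        ∑' k : ℕ, ((q : ℂ) ^ μ) ^ k / qPoch q q k * Complex.exp (-(x * (q : ℂ) ^ k)) := by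
  have hW := summable_modularTerm hq0 hq1 hreg hx
  have hG := summable_qCoef_mul_expTerm hq0 hq1 hμ hx
  have hrow : ∀ n : ℕ, (qKappa q : ℂ) / (2 * Real.pi) * ∑' m : ℤ, modularTerm q μ x (n, m) =
      ∑' k : ℤ, (-1) ^ n * qCoef q n * expTerm q (μ + n) x k := fun n => by
    have hc : (-1) ^ n * qCoef q n ≠ 0 := mul_ne_zero (by simp) (qCoef_ne_zero hq0 hq1 n)
    have hs : Summable fun m : ℤ => gammaPow (μ + n + qKappa q * m * Complex.I) x :=
      (summable_mul_left_iff hc).1 (hW.prod_factor n)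
    rw [tsum_mul_left, tsum_expTerm hq0 hq1 (by simp; linarith [n.cast_nonneg (α := ℝ)]) hx hs]
    simp only [modularTerm, latticePt]
    rw [tsum_mul_left]
    ring
  rw [hW.tsum_prod, ← tsum_mul_left, tsum_congr hrow, ← tsum_eulerEntire_mul hq0 hq1,
    ← Summable.tsum_comm (f := fun (n : ℕ) (k : ℤ) =>
      (-1) ^ n * qCoef q n * expTerm q (μ + n) x k) hG]
  refine tsum_congr fun k => ?_
  rw [eulerEntire, ← tsum_mul_right]
  refine tsum_congr fun n => ?_
  rw [expTerm_int hq0, neg_pow]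
  ring

/-! ### Descent from μ + 1 to μ -/

theorem norm_qPoch_le {q : ℝ} (hq0 : 0 < q) (hq1 : q < 1) (a : ℂ) (n : ℕ) :
    ‖qPoch a q n‖ ≤ (1 + ‖a‖) ^ n := by
  rw [qPoch, norm_prod]
  refine (Finset.prod_le_prod (fun _ _ => norm_nonneg _) (g := fun _ => 1 + ‖a‖)
    fun j _ => (norm_sub_le _ _).trans ?_).trans (by simp)
  have h := mul_le_mul_of_nonneg_left (pow_le_one₀ (n := j) hq0.le hq1.le) (norm_nonneg a)
  simpa [abs_of_pos hq0] using h

theorem ofReal_cpow_add_one {q : ℝ} (hq0 : 0 < q) (μ : ℂ) :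
    (q : ℂ) ^ (μ + 1) = (q : ℂ) ^ μ * q := by
  rw [Complex.cpow_add _ _ (Complex.ofReal_ne_zero.2 hq0.ne'), Complex.cpow_one]

theorem hasDerivAt_pantographF {q : ℝ} (hq0 : 0 < q) (hq1 : q < 1) (μ x : ℂ) :
    HasDerivAt (pantographF μ q) (-((1 - (q : ℂ) ^ μ) * pantographF (μ + 1) q x)) x := by
  set a : ℂ := (q : ℂ) ^ μ with ha
  let f : ℕ → ℂ → ℂ := fun n x => qPoch a q n / (n.factorial : ℂ) * (-x) ^ n
  have hU := Metric.isOpen_ball (x := (0 : ℂ)) (ε := ‖x‖ + 1)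
  have hxU : x ∈ Metric.ball (0 : ℂ) (‖x‖ + 1) := by simp
  have hdiff : ∀ n, DifferentiableOn ℂ (f n) (Metric.ball 0 (‖x‖ + 1)) := fun n => by fun_prop
  have hbound : ∀ n, ∀ z ∈ Metric.ball (0 : ℂ) (‖x‖ + 1),
      ‖f n z‖ ≤ ((1 + ‖a‖) * (‖x‖ + 1)) ^ n / n.factorial := fun n z hz => by
    rw [mem_ball_zero_iff] at hz
    rw [norm_mul, norm_div, norm_pow, norm_neg, Complex.norm_natCast, mul_pow, mul_div_right_comm]
    gcongr
    exact norm_qPoch_le hq0 hq1 a n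
  have hu := Real.summable_pow_div_factorial ((1 + ‖a‖) * (‖x‖ + 1))
  have h1 := Complex.hasSum_deriv_of_summable_norm hu hdiff hU hbound hxU
  have h2 := ((Complex.differentiableOn_tsum_of_summable_norm hu hdiff hU hbound).differentiableAt
    (hU.mem_nhds hxU)).hasDerivAt
  rw [← h1.tsum_eq] at h2
  refine h2.congr_deriv ?_
  have hd : ∀ n, deriv (f n) x =
      qPoch a q n / (n.factorial : ℂ) * (n * (-x) ^ (n - 1) * -1) := fun n =>
    (((hasDerivAt_neg x).pow n).const_mul _).deriv
  rw [h1.summable.tsum_eq_zero_add, pantographF, ← tsum_mul_left, ← tsum_neg]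
  simp only [hd, Nat.cast_zero, zero_mul, mul_zero, zero_add]
  refine tsum_congr fun n => ?_
  have h3 : (n.factorial : ℂ) ≠ 0 := Nat.cast_ne_zero.2 n.factorial_ne_zero
  have h4 : (n : ℂ) + 1 ≠ 0 := Nat.cast_add_one_ne_zero n
  rw [ofReal_cpow_add_one hq0, ← ha, qPoch_succ', Nat.factorial_succ, Nat.add_sub_cancel]
  push_cast
  field_simp

/-- Coefficientwise, this compares the two ways of splitting a factor off (a;q)_{n+1}: the last one,
1 - a q^n, or the first one, 1 - a. -/
theorem pantographF_qdiff {q : ℝ} (hq0 : 0 < q) (hq1 : q < 1) (μ x : ℂ) :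
    pantographF μ q x - (q : ℂ) ^ μ * pantographF μ q (q * x) =
      (1 - (q : ℂ) ^ μ) * pantographF (μ + 1) q x := by
  have h1 := summable_pantographF μ hq0 hq1 x
  have h2 := (summable_pantographF μ hq0 hq1 (q * x)).mul_left ((q : ℂ) ^ μ)
  rw [pantographF, pantographF, pantographF, ← tsum_mul_left, ← tsum_mul_left, ← h1.tsum_sub h2]
  refine tsum_congr fun n => ?_
  have h3 := (qPoch_succ ((q : ℂ) ^ μ) q n).symm.trans (qPoch_succ' ((q : ℂ) ^ μ) q n)
  rw [ofReal_cpow_add_one hq0, ← mul_neg, mul_pow]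
  linear_combination (-x) ^ n / (n.factorial : ℂ) * h3

/-- The solutions of q^μ = 1 are the points κki, excluded by the case m = 0 of regularity. -/
theorem IsRegularExponent.cpow_ne_one {q : ℝ} (hq0 : 0 < q) (hq1 : q < 1) {μ : ℂ}
    (h : IsRegularExponent (qKappa q) μ) : (q : ℂ) ^ μ ≠ 1 := by
  intro h1
  have h0 : (q : ℂ) ≠ 0 := Complex.ofReal_ne_zero.2 hq0.ne'
  have hl : (Real.log q : ℂ) ≠ 0 := Complex.ofReal_ne_zero.2 (Real.log_neg hq0 hq1).ne
  rw [Complex.cpow_def_of_ne_zero h0, Complex.exp_eq_one_iff, ← Complex.ofReal_log hq0.le] at h1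
  obtain ⟨n, hn⟩ := h1
  refine h 0 (-n) ?_
  rw [qKappa]
  push_cast
  field_simp
  linear_combination hn

/-- The constant in front of the transformation formula. -/
noncomputable def modularConst (q : ℝ) (μ : ℂ) : ℂ :=
  (qKappa q : ℂ) * qPochInf ((q : ℂ) ^ μ) q / (2 * (Real.pi : ℂ) * qPochInf (q : ℂ) q)

theorem modularConst_eq_mul {q : ℝ} (hq0 : 0 < q) (hq1 : q < 1) (μ : ℂ) :
    modularConst q μ = (1 - (q : ℂ) ^ μ) * modularConst q (μ + 1) := by
  rw [modularConst, modularConst, qPochInf_eq_mul hq0 hq1 ((q : ℂ) ^ μ), ofReal_cpow_add_one hq0]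
  ring

theorem pantographF_eq_of_one_le_re {q : ℝ} (hq0 : 0 < q) (hq1 : q < 1) {μ x : ℂ}
    (hreg : IsRegularExponent (qKappa q) μ) (hμ : 1 ≤ μ.re) (hx : 0 < x.re) :
    pantographF μ q x = modularConst q μ * ∑' p, modularTerm q μ x p := by
  have ha : ‖(q : ℂ) ^ μ‖ < 1 := by
    rw [Complex.norm_cpow_eq_rpow_re_of_pos hq0]
    exact Real.rpow_lt_one hq0.le hq1 (by linarith)
  have h1 := tsum_modularTerm_of_one_le_re hq0 hq1 hreg hμ hx
  have h2 := qPochInf_self_ne_zero hq0 hq1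
  rw [pantographF_eq_tsum_exp hq0 hq1 ha, modularConst]
  calc _ = qPochInf ((q : ℂ) ^ μ) q / qPochInf q q * (qPochInf q q *
        ∑' k : ℕ, ((q : ℂ) ^ μ) ^ k / qPoch q q k * Complex.exp (-(x * (q : ℂ) ^ k))) := by
        field_simp
    _ = _ := by
        rw [← h1]
        ring

/-- Descent of the transformation formula from `μ + 1` to `μ`: the difference of both sides is
constant in `x` and is multiplied by `q ^ (-μ)` when `x` is replaced by `q x`. -/
theorem pantographF_eq_of_add_one {q : ℝ} (hq0 : 0 < q) (hq1 : q < 1) {μ : ℂ}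
    (hreg : IsRegularExponent (qKappa q) μ)
    (h : ∀ x : ℂ, 0 < x.re →
      pantographF (μ + 1) q x = modularConst q (μ + 1) * ∑' p, modularTerm q (μ + 1) x p)
    {x : ℂ} (hx : 0 < x.re) :
    pantographF μ q x = modularConst q μ * ∑' p, modularTerm q μ x p := by
  let D : ℂ → ℂ := fun x => pantographF μ q x - modularConst q μ * ∑' p, modularTerm q μ x p
  have hD : ∀ z ∈ {z : ℂ | 0 < z.re}, HasDerivAt D 0 z := fun z hz => by
    refine ((hasDerivAt_pantographF hq0 hq1 μ z).sub
      ((hasDerivAt_tsum_modularTerm hq0 hq1 hreg hz).const_mul _)).congr_deriv ?_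
    rw [modularConst_eq_mul hq0 hq1, h z hz]
    ring
  have hqx : 0 < ((q : ℂ) * x).re := by simpa using mul_pos hq0 hx
  have hconst : D (q * x) = D x :=
    isOpen_rightHalfPlane.is_const_of_deriv_eq_zero convex_rightHalfPlane.isPreconnected
      (fun z hz => (hD z hz).differentiableAt.differentiableWithinAt)
      (fun z hz => (hD z hz).deriv) hqx hx
  have hq : D x - (q : ℂ) ^ μ * D (q * x) = 0 := by
    have h1 := pantographF_qdiff hq0 hq1 μ x
    have h2 := tsum_modularTerm_qdiff hq0 hq1 hreg hx
    have h3 := modularConst_eq_mul hq0 hq1 μ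
    rw [h x hx] at h1
    simp only [D]
    linear_combination h1 - modularConst q μ * h2 - (∑' p, modularTerm q (μ + 1) x p) * h3
  -- Constancy reduces the q-difference equation to (1 - q^μ) D(x) = 0.
  have hne : 1 - (q : ℂ) ^ μ ≠ 0 := sub_ne_zero.2 (hreg.cpow_ne_one hq0 hq1).symm
  rw [hconst] at hq
  have h0 : D x = 0 := (mul_eq_zero.1 (by linear_combination hq :
    (1 - (q : ℂ) ^ μ) * D x = 0)).resolve_left hne
  exact sub_eq_zero.1 h0

theorem pantographF_eq_tsum_modularTerm {q : ℝ} (hq0 : 0 < q) (hq1 : q < 1) {μ : ℂ}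
    (hreg : IsRegularExponent (qKappa q) μ) {x : ℂ} (hx : 0 < x.re) :
    pantographF μ q x = modularConst q μ * ∑' p, modularTerm q μ x p := by
  -- N counts the unit shifts needed to reach Re μ ≥ 1.
  obtain ⟨N, hN⟩ := exists_nat_ge (1 - μ.re)
  induction N generalizing μ x with
  | zero => exact pantographF_eq_of_one_le_re hq0 hq1 hreg (by simpa using hN) hx
  | succ N ih =>
    exact pantographF_eq_of_add_one hq0 hq1 hreg (fun z hz => ih hreg.add_one hz
      (by push_cast at hN; simp; linarith)) hx

/-! ### Return to the Laurent series Ψ -/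

/-- With v = κπ/2 the shift 2ivm/π is κmi. Since x avoids the negative axis, log(1/x) = -log x, so
all the powers are exponentials of multiples of log x. -/
theorem modularTerm_eq_psiTerm {q : ℝ} (μ : ℂ) {x : ℂ} (hx : 0 < x.re) (n : ℕ) (m : ℤ) :
    modularTerm q μ x (n, m) = (1 / x) ^ μ * (qCoef q n *
      psiTerm (μ + n) (qKappa q * Real.pi / 2) (modularVar q x) m * (-(1 / x)) ^ n) := by
  have hx0 : x ≠ 0 := by rintro rfl; simp at hx
  have hpi : (Real.pi : ℂ) ≠ 0 := Complex.ofReal_ne_zero.2 Real.pi_ne_zero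
  have harg : x.arg ≠ Real.pi := Complex.mem_slitPlane_iff_arg.1 (mem_slitPlane_of_re_pos hx) |>.1
  have h1 : (1 / x) ^ μ = Complex.exp (-(μ * Complex.log x)) := by
    rw [Complex.cpow_def_of_ne_zero (one_div_ne_zero hx0), one_div, Complex.log_inv _ harg]
    ring_nf
  have h2 : (-(1 / x)) ^ n = (-1) ^ n * Complex.exp (-(n * Complex.log x)) := by
    rw [neg_pow, Complex.exp_neg, Complex.exp_nat_mul, Complex.exp_log hx0, one_div, inv_pow]
  have h3 : modularVar q x ^ m = Complex.exp (-(qKappa q * m * Complex.I * Complex.log x)) := by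
    rw [modularVar, Complex.cpow_def_of_ne_zero hx0, ← Complex.exp_int_mul]
    ring_nf
  have h4 : μ + n + 2 * Complex.I * ((qKappa q * Real.pi / 2 : ℝ) : ℂ) * m / Real.pi =
      latticePt (qKappa q) μ (n, m) := by
    rw [latticePt]
    push_cast
    field_simp
  have h5 : Complex.exp (-(latticePt (qKappa q) μ (n, m) * Complex.log x)) =
      Complex.exp (-(μ * Complex.log x)) * Complex.exp (-(n * Complex.log x)) *
        Complex.exp (-(qKappa q * m * Complex.I * Complex.log x)) := by
    rw [← Complex.exp_add, ← Complex.exp_add, latticePt]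
    ring_nf
  rw [modularTerm, gammaPow, psiTerm, h1, h2, h3, h4, h5]
  ring

theorem theorem1p4 (q : ℝ) (hq0 : 0 < q) (hq1 : q < 1) (μ : ℂ)
    (hμ : ∀ (m : ℕ) (k : ℤ), μ ≠ -(m : ℂ) + (qKappa q : ℂ) * (k : ℂ) * Complex.I)
    (x : ℂ) (hx : 0 < x.re) :
    (∀ n : ℕ, Summable (psiTerm (μ + (n : ℂ)) (qKappa q * Real.pi / 2) (modularVar q x))) ∧
    (Summable fun n : ℕ =>
      (q : ℂ) ^ (n * (n + 1) / 2) / qPoch (q : ℂ) q n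
        * gammaPsi (μ + (n : ℂ)) (qKappa q * Real.pi / 2) (modularVar q x) * (-(1 / x)) ^ n) ∧
    pantographF μ q x =
      (qKappa q : ℂ) * qPochInf ((q : ℂ) ^ μ) q / (2 * (Real.pi : ℂ) * qPochInf (q : ℂ) q)
        * (1 / x) ^ μ
        * ∑' n : ℕ,
            (q : ℂ) ^ (n * (n + 1) / 2) / qPoch (q : ℂ) q n
              * gammaPsi (μ + (n : ℂ)) (qKappa q * Real.pi / 2) (modularVar q x)
              * (-(1 / x)) ^ n := by
  have hreg : IsRegularExponent (qKappa q) μ := hμ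
  have hx0 : x ≠ 0 := by rintro rfl; simp at hx
  have hW := summable_modularTerm hq0 hq1 hreg hx
  have hpow : (1 / x) ^ μ ≠ 0 := by
    rw [Complex.cpow_def_of_ne_zero (one_div_ne_zero hx0)]
    exact Complex.exp_ne_zero _
  have hrow : ∀ n : ℕ, ∑' m : ℤ, modularTerm q μ x (n, m) = (1 / x) ^ μ *
      ((q : ℂ) ^ (n * (n + 1) / 2) / qPoch (q : ℂ) q n
        * gammaPsi (μ + (n : ℂ)) (qKappa q * Real.pi / 2) (modularVar q x) * (-(1 / x)) ^ n) :=
    fun n => by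
      simp_rw [modularTerm_eq_psiTerm μ hx]
      rw [tsum_mul_left, tsum_mul_right, tsum_mul_left, qCoef, gammaPsi]
  refine ⟨fun n => ?_, ?_, ?_⟩
  -- Each row of the summable double series is summable; the factors independent of m are nonzero
  -- and cancel.
  · have h1 := hW.prod_factor n
    simp_rw [modularTerm_eq_psiTerm μ hx] at h1
    have h2 : (-(1 / x)) ^ n ≠ 0 := pow_ne_zero _ (neg_ne_zero.2 (one_div_ne_zero hx0))
    exact (summable_mul_left_iff (qCoef_ne_zero hq0 hq1 n)).1
      ((summable_mul_right_iff h2).1 ((summable_mul_left_iff hpow).1 h1))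
  · exact (summable_mul_left_iff hpow).1 (hW.prod.congr hrow)
  · rw [pantographF_eq_tsum_modularTerm hq0 hq1 hreg hx, hW.tsum_prod, tsum_congr hrow,
      tsum_mul_left, modularConst, ← mul_assoc]
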